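/- For a topological space $X$ and an infinite cardinal $\kappa$, a base $\mathcal B$ of $X$ is \emph{$\kappa^{op}$-like} if every $U\in\mathcal B$ has fewer than $\kappa$ supersets in $\mathcal B$. The \emph{Noetherian type} $\mathrm{Nt}(X)$ is the least infinite cardinal $\kappa$ such that $X$ has a $\kappa^{op}$-like base, and the \emph{weight} $w(X)$ is the least infinite cardinal $\kappa$ such that $X$ has a base of cardinality at most $\kappa$. A \emph{compactum} is a compact Hausdorff space; a space is \emph{homogeneous} if for all points $x,y$ there is an autohomeomorphism taking $x$ to $y$. (1) If $X$ is a homogeneous compactum and $w(X)$ is a regular cardinal, then every base of $X$ contains an $\mathrm{Nt}(X)^{op}$-like base of $X$. (2) Suppose that every limit cardinal is a strong limit cardinal. Then for every homogeneous compactum $X$, every base of $X$ contains an $\mathrm{Nt}(X)^{op}$-like base of $X$. (3) Assume GCH, i.e. $2^\kappa=\kappa^+$ for every infinite cardinal $\kappa$. Then for every homogeneous compactum $X$ and every integer $n\ge 1$, $\mathrm{Nt}(X^n)=\mathrm{Nt}(X)$, where $X^n$ has the product topology. -/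

import Mathlib

open Cardinal TopologicalSpace

universe u

/-- A poset `P` is `κ^op`-like if every `p : P` has fewer than `κ` elements above it
(itself included). -/
def IsOpLike (κ : Cardinal.{u}) (P : Type u) [PartialOrder P] : Prop :=
  ∀ p : P, #{x : P // p ≤ x} < κ

/-- The op-character of a poset: the least infinite `κ` such that it is `κ^op`-like. -/
noncomputable def opCharacter (P : Type u) [PartialOrder P] : Cardinal.{u} :=
  sInf {κ | ℵ₀ ≤ κ ∧ IsOpLike κ P}

/-- A family `B` of sets is `κ^op`-like if every member of `B` has fewer than `κ` supersets
in `B`; the order on the subtype `B` is inclusion. -/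
def IsOpLikeFamily {X : Type u} (κ : Cardinal.{u}) (B : Set (Set X)) : Prop :=
  IsOpLike κ B

/-- The Noetherian type `Nt(X)`: the least op-character of a base of `X`, where bases are
ordered by inclusion. -/
noncomputable def Nt (X : Type u) [TopologicalSpace X] : Cardinal.{u} :=
  sInf {κ | ∃ B : Set (Set X), IsTopologicalBasis B ∧ opCharacter B = κ}

/-- The weight of a space: the least infinite cardinal `κ` such that there is a base of
cardinality at most `κ`. -/
noncomputable def weight (X : Type u) [TopologicalSpace X] : Cardinal.{u} :=
  sInf {κ | ℵ₀ ≤ κ ∧ ∃ B : Set (Set X), IsTopologicalBasis B ∧ #B ≤ κ}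

/-- A space is homogeneous if any point can be moved to any other by an autohomeomorphism. -/
def IsHomogeneousSpace (X : Type u) [TopologicalSpace X] : Prop :=
  ∀ x y : X, ∃ h : X ≃ₜ X, h x = y

/-- Every base of `X` contains an `Nt(X)^op`-like base of `X`. -/
def EveryBaseContainsNtOpLikeBase (X : Type u) [TopologicalSpace X] : Prop :=
  ∀ A : Set (Set X), IsTopologicalBasis A →
    ∃ B : Set (Set X), B ⊆ A ∧ IsTopologicalBasis B ∧ IsOpLikeFamily (Nt X) B

/-- Every limit cardinal is a strong limit cardinal. -/
def EveryLimitIsStrongLimit : Prop :=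
  ∀ κ : Cardinal.{u}, Order.IsSuccLimit κ → κ.IsStrongLimit

/-- The generalized continuum hypothesis. -/
def GCH : Prop :=
  ∀ κ : Cardinal.{u}, ℵ₀ ≤ κ → 2 ^ κ = Order.succ κ

/-! ### Reformulations of op-likeness, weight bounds, discrete spaces, products. -/

section Basic

variable {X : Type u}

/-! By homogeneity, either no point of `X` has a local base smaller than `w = w(X)`, or all points
do. If none does, every point lies in at least `w` members of any base `C`. Taking `C` to be
`Nt(X)^op`-like, `exists_isOpLikeFamily_subset` picks finite covers from the given base by recursion
of length at most `w`, each refining members of `C` not used before; op-likeness passes to the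
result. If all do and `w` is regular, then either `w = ℵ₀` and `X` is discrete, or Mishchenko's
lemma gives `w < Nt(X)` (`weight_lt_Nt`), so that any base of size at most `w` works. Regularity is
assumed in (1). In (2) and (3), an uncountable limit `w` would be a strong limit, contradicting
Arhangelskii's bound `w ≤ 2 ^ κ` with `κ < w`. For powers, boxes give `Nt(X^n) ≤ Nt(X)`. Conversely,
the selection argument is run along the diagonal in the first case; in the second, `Nt(X) ≤ w⁺ ≤
Nt(X^n)`. -/

theorem isOpLikeFamily_iff {κ : Cardinal.{u}} {B : Set (Set X)} :
    IsOpLikeFamily κ B ↔ ∀ p ∈ B, #{x : Set X | x ∈ B ∧ p ⊆ x} < κ := by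
  have key : ∀ p : B, #{x : B // p ≤ x} = #{x : Set X | x ∈ B ∧ p.1 ⊆ x} := fun p =>
    mk_congr (Equiv.subtypeSubtypeEquivSubtypeInter (· ∈ B) (fun x => p.1 ⊆ x))
  refine ⟨fun h p hp => key ⟨p, hp⟩ ▸ h ⟨p, hp⟩, fun h p => ?_⟩
  rw [key]
  exact h p.1 p.2

theorem IsOpLikeFamily.mono {κ : Cardinal.{u}} {B C : Set (Set X)} (h : IsOpLikeFamily κ B)
    (hC : C ⊆ B) : IsOpLikeFamily κ C := by
  rw [isOpLikeFamily_iff] at *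
  refine fun p hp => lt_of_le_of_lt (mk_le_mk_of_subset ?_) (h p (hC hp))
  exact fun x hx => ⟨hC hx.1, hx.2⟩

theorem isOpLikeFamily_of_mk_lt {κ : Cardinal.{u}} {B : Set (Set X)} (h : #B < κ) :
    IsOpLikeFamily κ B :=
  isOpLikeFamily_iff.2 fun _ _ => (mk_le_mk_of_subset fun _ hx => hx.1).trans_lt h

theorem opCharacter_spec (P : Type u) [PartialOrder P] :
    ℵ₀ ≤ opCharacter P ∧ IsOpLike (opCharacter P) P := by
  have hne : {κ | ℵ₀ ≤ κ ∧ IsOpLike κ P}.Nonempty := by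
    refine ⟨Order.succ (max #P ℵ₀), ?_, fun p => ?_⟩
    · exact (le_max_right _ _).trans (Order.le_succ _)
    · exact Order.lt_succ_of_le ((mk_subtype_le _).trans (le_max_left _ _))
  exact csInf_mem hne

theorem isOpLikeFamily_singletons {κ : Cardinal.{u}} (hκ : ℵ₀ ≤ κ) :
    IsOpLikeFamily κ {s : Set X | ∃ x, s = {x}} := by
  rw [isOpLikeFamily_iff]
  rintro _ ⟨x, rfl⟩
  refine lt_of_lt_of_le (lt_aleph0_iff_set_finite.2 ((Set.finite_singleton {x}).subset ?_)) hκ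
  rintro _ ⟨⟨y, rfl⟩, hy⟩
  simpa using (Set.singleton_subset_singleton.1 hy).symm

variable [TopologicalSpace X]

theorem exists_isOpLikeFamily_Nt (X : Type u) [TopologicalSpace X] :
    ℵ₀ ≤ Nt X ∧ ∃ B : Set (Set X), IsTopologicalBasis B ∧ IsOpLikeFamily (Nt X) B := by
  obtain ⟨B, hB, h⟩ := csInf_mem
    (s := {κ | ∃ B : Set (Set X), IsTopologicalBasis B ∧ opCharacter B = κ})
    ⟨_, _, isTopologicalBasis_opens, rfl⟩
  change opCharacter B = Nt X at h
  have := opCharacter_spec B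
  rw [h] at this
  exact ⟨this.1, B, hB, this.2⟩

theorem aleph0_le_Nt (X : Type u) [TopologicalSpace X] : ℵ₀ ≤ Nt X :=
  (exists_isOpLikeFamily_Nt X).1

theorem Nt_le {κ : Cardinal.{u}} (hκ : ℵ₀ ≤ κ) {B : Set (Set X)} (hB : IsTopologicalBasis B)
    (h : IsOpLikeFamily κ B) : Nt X ≤ κ := by
  have h1 : Nt X ≤ opCharacter B := csInf_le' (Set.mem_ofPred.2 ⟨B, hB, rfl⟩)
  exact h1.trans (csInf_le' (Set.mem_ofPred.2 ⟨hκ, h⟩))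

theorem exists_basis_mk_le_weight (X : Type u) [TopologicalSpace X] :
    ℵ₀ ≤ weight X ∧ ∃ B : Set (Set X), IsTopologicalBasis B ∧ #B ≤ weight X := by
  have hne : {κ | ℵ₀ ≤ κ ∧ ∃ B : Set (Set X), IsTopologicalBasis B ∧ #B ≤ κ}.Nonempty :=
    ⟨max #{U : Set X | IsOpen U} ℵ₀, le_max_right _ _, _, isTopologicalBasis_opens,
      le_max_left _ _⟩
  exact csInf_mem hne

theorem aleph0_le_weight (X : Type u) [TopologicalSpace X] : ℵ₀ ≤ weight X :=
  (exists_basis_mk_le_weight X).1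

theorem weight_le {κ : Cardinal.{u}} (hκ : ℵ₀ ≤ κ) {B : Set (Set X)} (hB : IsTopologicalBasis B)
    (h : #B ≤ κ) : weight X ≤ κ :=
  csInf_le' (Set.mem_ofPred.2 ⟨hκ, B, hB, h⟩)

/-- Every base contains a base of cardinality at most the weight. -/
theorem TopologicalSpace.IsTopologicalBasis.exists_subset_mk_le_weight {A : Set (Set X)}
    (hA : IsTopologicalBasis A) :
    ∃ B ⊆ A, IsTopologicalBasis B ∧ #B ≤ weight X := by
  obtain ⟨hw, D, hD, hDw⟩ := exists_basis_mk_le_weight X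
  -- One member of `A` per interpolable pair from `D` suffices, and there are at most `w(X)` pairs.
  let I := {q : D × D // ∃ W ∈ A, q.1.1 ⊆ W ∧ W ⊆ q.2.1}
  choose W hWA h1 h2 using fun q : I => q.2
  refine ⟨Set.range W, Set.range_subset_iff.2 hWA, ?_, ?_⟩
  · refine isTopologicalBasis_of_isOpen_of_nhds ?_ fun p O hp hO => ?_
    · rintro _ ⟨q, rfl⟩
      exact hA.isOpen (hWA q)
    obtain ⟨V, hV, hpV, hVO⟩ := hD.exists_subset_of_mem_open hp hO
    obtain ⟨T, hT, hpT, hTV⟩ := hA.exists_subset_of_mem_open hpV (hD.isOpen hV)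
    obtain ⟨U, hU, hpU, hUT⟩ := hD.exists_subset_of_mem_open hpT (hA.isOpen hT)
    let q : I := ⟨(⟨U, hU⟩, ⟨V, hV⟩), T, hT, hUT, hTV⟩
    exact ⟨W q, ⟨q, rfl⟩, h1 q hpU, (h2 q).trans hVO⟩
  · calc #(Set.range W) ≤ #I := mk_range_le
      _ ≤ #(D × D) := mk_subtype_le _
      _ = #D * #D := by simp
      _ ≤ weight X * weight X := mul_le_mul' hDw hDw
      _ = weight X := mul_eq_self hw

theorem Nt_le_succ_weight (X : Type u) [TopologicalSpace X] : Nt X ≤ Order.succ (weight X) := by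
  obtain ⟨hw, D, hD, hDw⟩ := exists_basis_mk_le_weight X
  exact Nt_le (hw.trans (Order.le_succ _)) hD (isOpLikeFamily_of_mk_lt (Order.lt_succ_of_le hDw))

theorem everyBaseContainsNtOpLikeBase_of_weight_lt (h : weight X < Nt X) :
    EveryBaseContainsNtOpLikeBase X := fun _ hA =>
  let ⟨B, hBA, hB, hBw⟩ := hA.exists_subset_mk_le_weight
  ⟨B, hBA, hB, isOpLikeFamily_of_mk_lt (hBw.trans_lt h)⟩

theorem TopologicalSpace.IsTopologicalBasis.singleton_mem [DiscreteTopology X]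
    {A : Set (Set X)} (hA : IsTopologicalBasis A) (x : X) : {x} ∈ A := by
  obtain ⟨V, hV, hxV, hV'⟩ :=
    hA.exists_subset_of_mem_open (Set.mem_singleton x) (isOpen_discrete {x})
  rwa [← (Set.subset_singleton_iff_eq.1 hV').resolve_left (Set.nonempty_of_mem hxV).ne_empty]

theorem Nt_eq_aleph0_of_discrete [DiscreteTopology X] : Nt X = ℵ₀ :=
  le_antisymm (Nt_le le_rfl (isTopologicalBasis_singletons X)
    (isOpLikeFamily_singletons le_rfl)) (aleph0_le_Nt X)

theorem everyBaseContainsNtOpLikeBase_of_discrete [DiscreteTopology X] :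
    EveryBaseContainsNtOpLikeBase X := fun A hA =>
  ⟨_, by rintro _ ⟨x, rfl⟩; exact hA.singleton_mem x, isTopologicalBasis_singletons X,
    isOpLikeFamily_singletons (aleph0_le_Nt X)⟩

theorem Cardinal.mk_pi_lt_of_finite {ι : Type} [Finite ι] {κ : Cardinal.{u}} (hκ : ℵ₀ ≤ κ)
    (S : ι → Type u) (h : ∀ i, #(S i) < κ) : #(∀ i, S i) < κ := by
  have := Fintype.ofFinite ι
  rw [mk_pi, prod_eq_of_fintype, lift_uzero]
  exact Finset.prod_induction (fun i => #(S i)) (· < κ) (fun a b ha hb => mul_lt_of_lt hκ ha hb)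
    (one_lt_aleph0.trans_le hκ) (fun i _ => h i)

theorem Nt_pi_le {ι : Type} [Finite ι] : Nt (ι → X) ≤ Nt X := by
  obtain ⟨hκ, B₀, hB₀, hop₀⟩ := exists_isOpLikeFamily_Nt X
  have hB := hB₀.sdiff_empty
  -- Without empty factors, inclusion of boxes is inclusion of each factor.
  have hop := hop₀.mono (Set.sdiff_subset : B₀ \ {∅} ⊆ B₀)
  set B := B₀ \ {∅} with hBdef
  let C : Set (Set (ι → X)) := (Set.univ.pi) '' {U : ι → Set X | ∀ i, U i ∈ B}
  refine Nt_le hκ (B := C) ?_ ?_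
  · refine isTopologicalBasis_of_isOpen_of_nhds ?_ fun p O hp hO => ?_
    · rintro _ ⟨U, hU, rfl⟩
      exact isOpen_set_pi Set.finite_univ fun i _ => hB.isOpen (hU i)
    obtain ⟨I, u, hu, huO⟩ := isOpen_pi_iff.1 hO p hp
    have : ∀ i, ∃ v ∈ B, p i ∈ v ∧ (i ∈ I → v ⊆ u i) := fun i => by
      by_cases hi : i ∈ I
      · obtain ⟨v, hv, hpv, hvu⟩ := hB.exists_subset_of_mem_open (hu i hi).2 (hu i hi).1
        exact ⟨v, hv, hpv, fun _ => hvu⟩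
      · obtain ⟨v, hv, hpv, -⟩ := hB.exists_subset_of_mem_open (Set.mem_univ (p i)) isOpen_univ
        exact ⟨v, hv, hpv, fun h => (hi h).elim⟩
    choose v hv hpv hvu using this
    exact ⟨_, ⟨v, hv, rfl⟩, fun i _ => hpv i, fun q hq => huO fun i hi => hvu i hi (hq i trivial)⟩
  · rw [isOpLikeFamily_iff] at hop ⊢
    rintro _ ⟨U, hU, rfl⟩
    have hne : (Set.univ.pi U).Nonempty := Set.univ_pi_nonempty_iff.2 fun i =>
      Set.nonempty_iff_ne_empty.2 (hU i).2
    refine lt_of_le_of_lt ?_ (mk_pi_lt_of_finite hκ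
      (fun i => {x : Set X | x ∈ B ∧ U i ⊆ x}) fun i => hop _ (hU i))
    refine mk_le_of_surjective (f := fun V => ⟨Set.univ.pi fun i => (V i).1,
      ⟨_, fun i => (V i).2.1, rfl⟩, Set.pi_mono fun i _ => (V i).2.2⟩) ?_
    rintro ⟨_, ⟨V, hV, rfl⟩, hUV⟩
    refine ⟨fun i => ⟨V i, hV i, ?_⟩, rfl⟩
    exact (Set.pi_subset_pi_iff.1 hUV).resolve_right hne.ne_empty i trivial

theorem Cardinal.mk_lt_of_finite_preimage {α β : Type u} {κ : Cardinal.{u}} (hκ : ℵ₀ ≤ κ)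
    (f : α → β) (hf : ∀ b, (f ⁻¹' {b}).Finite) (hβ : #β < κ) : #α < κ := by
  rcases lt_or_ge #β ℵ₀ with h | h
  · have := lt_aleph0_iff_finite.1 h
    have : Finite α := by
      by_contra hα
      rw [not_finite_iff_infinite] at hα
      obtain ⟨b, hb⟩ := Finite.exists_infinite_fiber f
      exact not_finite_iff_infinite.2 hb (hf b).to_subtype
    exact (lt_aleph0_of_finite α).trans_le hκ
  · calc #α ≤ #β * ℵ₀ := mk_le_mk_mul_of_mk_preimage_le f fun b => (lt_aleph0_iff_set_finite.2 (hf b)).le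
      _ = #β := mul_aleph0_eq h
      _ < κ := hβ

end Basic

/-! ### Small local bases and Mishchenko's lemma. -/

section LocalBase

open Topology Filter

variable {X : Type u} [TopologicalSpace X]

/-- The point `p` has a base of open neighbourhoods of cardinality less than `κ`. -/
def HasNhdsBaseLT (κ : Cardinal.{u}) (p : X) : Prop :=
  ∃ S : Set (Set X), #S < κ ∧ (∀ s ∈ S, IsOpen s ∧ p ∈ s) ∧
    ∀ O, IsOpen O → p ∈ O → ∃ s ∈ S, s ⊆ O

theorem HasNhdsBaseLT.of_isInducing {Y : Type u} [TopologicalSpace Y] {κ : Cardinal.{u}}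
    {d : X → Y} (hd : IsInducing d) {p : X} {S : Set (Set Y)} (hS : #S < κ)
    (hSp : ∀ s ∈ S, IsOpen s ∧ d p ∈ s) (h : ∀ O, IsOpen O → d p ∈ O → ∃ s ∈ S, s ⊆ O) :
    HasNhdsBaseLT κ p := by
  refine ⟨(d ⁻¹' ·) '' S, mk_image_le.trans_lt hS, ?_, fun O hO hp => ?_⟩
  · rintro _ ⟨s, hs, rfl⟩
    exact ⟨(hSp s hs).1.preimage hd.continuous, (hSp s hs).2⟩
  · obtain ⟨O', hO', rfl⟩ := hd.isOpen_iff.1 hO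
    obtain ⟨s, hs, hsO⟩ := h O' hO' hp
    exact ⟨_, ⟨s, hs, rfl⟩, Set.preimage_mono hsO⟩

theorem IsHomogeneousSpace.hasNhdsBaseLT (hX : IsHomogeneousSpace X) {κ : Cardinal.{u}} {p : X}
    (hp : HasNhdsBaseLT κ p) (q : X) : HasNhdsBaseLT κ q := by
  obtain ⟨h, rfl⟩ := hX q p
  obtain ⟨S, hS, h1, h2⟩ := hp
  exact .of_isInducing h.isInducing hS h1 h2

/-- The members of `C` through `d p` pull back to a local base at `p`. -/
theorem le_mk_of_not_hasNhdsBaseLT {Y : Type u} [TopologicalSpace Y] {κ : Cardinal.{u}}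
    {d : X → Y} (hd : IsInducing d) {p : X} (hp : ¬ HasNhdsBaseLT κ p) {C : Set (Set Y)}
    (hC : IsTopologicalBasis C) : κ ≤ #{c : Set Y | c ∈ C ∧ d p ∈ c} := by
  by_contra! h
  refine hp (.of_isInducing hd h (fun s hs => ⟨hC.isOpen hs.1, hs.2⟩) fun O hO hpO => ?_)
  obtain ⟨s, hs, hps, hsO⟩ := hC.exists_subset_of_mem_open hpO hO
  exact ⟨s, ⟨hs, hps⟩, hsO⟩

theorem HasNhdsBaseLT.pi {ι : Type} [Finite ι] {κ : Cardinal.{u}} (hκ : ℵ₀ ≤ κ) {p : ι → X}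
    (hp : ∀ i, HasNhdsBaseLT κ (p i)) : HasNhdsBaseLT κ p := by
  choose S hS h1 h2 using hp
  refine ⟨Set.range fun U : ∀ i, S i => Set.univ.pi fun i => (U i).1,
    mk_range_le.trans_lt (mk_pi_lt_of_finite hκ (fun i => S i) hS), ?_, fun O hO hpO => ?_⟩
  · rintro _ ⟨U, rfl⟩
    exact ⟨isOpen_set_pi Set.finite_univ fun i _ => (h1 i _ (U i).2).1,
      fun i _ => (h1 i _ (U i).2).2⟩
  · obtain ⟨I, u, hu, huO⟩ := isOpen_pi_iff.1 hO p hpO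
    have : ∀ i, ∃ v ∈ S i, i ∈ I → v ⊆ u i := fun i => by
      by_cases hi : i ∈ I
      · obtain ⟨v, hv, hvu⟩ := h2 i _ (hu i hi).1 (hu i hi).2
        exact ⟨v, hv, fun _ => hvu⟩
      · obtain ⟨v, hv, -⟩ := h2 i _ isOpen_univ (Set.mem_univ _)
        exact ⟨v, hv, fun h => (hi h).elim⟩
    choose v hv hvu using this
    exact ⟨_, ⟨fun i => ⟨v i, hv i⟩, rfl⟩, fun q hq => huO fun i hi => hvu i hi (hq i trivial)⟩

theorem HasNhdsBaseLT.isOpen_singleton [T1Space X] {p : X} (hp : HasNhdsBaseLT ℵ₀ p) :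
    IsOpen {p} := by
  obtain ⟨S, hS, h1, h2⟩ := hp
  have : {p} = ⋂₀ S := by
    refine subset_antisymm (by simpa using fun s hs => (h1 s hs).2) fun q hq => ?_
    by_contra hqp
    obtain ⟨s, hs, hs'⟩ := h2 {q}ᶜ isOpen_compl_singleton (fun h => hqp (by simp_all))
    exact hs' (hq s hs) rfl
  rw [this]
  exact (lt_aleph0_iff_set_finite.1 hS).isOpen_sInter fun s hs => (h1 s hs).1

/-- A form of Mishchenko's lemma: a base of a compact Hausdorff space all of whose points lie in
fewer than `μ` members of the base has itself fewer than `μ` nonempty members. -/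
theorem mk_lt_of_forall_mk_mem_lt {Z : Type u} [TopologicalSpace Z] [CompactSpace Z] [T2Space Z]
    {μ : Cardinal.{u}} (hμ : μ.IsRegular) (hμ' : ℵ₀ < μ) {C : Set (Set Z)}
    (hC : IsTopologicalBasis C) (h : ∀ z, #{c : Set Z | c ∈ C ∧ z ∈ c} < μ) :
    #(C \ {∅} : Set (Set Z)) < μ := by
  classical
  rcases isEmpty_or_nonempty Z with hZ | hZ
  · have : Finite (Set Z) := inferInstance
    exact (lt_aleph0_of_finite _).trans hμ'
  have hpt : ∀ F : Finset (Set Z), ∃ z, ⋃₀ (F : Set (Set Z)) ≠ Set.univ → z ∉ ⋃₀ (F : Set (Set Z)) :=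
    fun F => by
      by_cases hF : ⋃₀ (F : Set (Set Z)) = Set.univ
      · exact ⟨Classical.arbitrary Z, fun h => (h hF).elim⟩
      · obtain ⟨z, hz⟩ := (Set.ne_univ_iff_exists_notMem _).1 hF
        exact ⟨z, fun _ => hz⟩
  choose pt hpt using hpt
  -- For each finite `F ⊆ M` that fails to cover, add all members of `C` through a chosen uncovered
  -- point. Iterating `ω` times keeps the size below `μ`.
  let step : Set (Set Z) → Set (Set Z) := fun M =>
    ⋃ F : Finset M, {c | c ∈ C ∧ pt (F.map (Function.Embedding.subtype _)) ∈ c}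
  obtain ⟨M, hM0, hM⟩ : ∃ M : ℕ → Set (Set Z), M 0 = ∅ ∧ ∀ n, M (n + 1) = M n ∪ step (M n) :=
    ⟨fun n => Nat.rec ∅ (fun _ M => M ∪ step M) n, rfl, fun _ => rfl⟩
  have hmono : Monotone M := monotone_nat_of_le_succ fun n => by
    rw [hM]; exact Set.subset_union_left
  have hcard : ∀ n : ℕ, #(M n) < μ := by
    intro n
    induction n with
    | zero => exact (by simpa [hM0] using hμ.pos)
    | succ n ih =>
      rw [hM]
      refine (mk_union_le _ _).trans_lt (add_lt_of_lt hμ.aleph0_le ih ?_)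
      refine (card_iUnion_lt_iff_forall_of_isRegular hμ ?_).2 fun F => h _
      rcases finite_or_infinite (M n) with hf | hf
      · exact (lt_aleph0_of_finite _).trans hμ'
      · rwa [mk_finset_of_infinite]
  have htot : #(⋃ n : ULift.{u} ℕ, M n.down) < μ :=
    (card_iUnion_lt_iff_forall_of_isRegular hμ (by simpa using hμ')).2 fun n => hcard _
  refine lt_of_le_of_lt (mk_le_mk_of_subset ?_) htot
  rintro c₀ ⟨hc₀, hne⟩
  obtain ⟨p, hp⟩ := Set.nonempty_iff_ne_empty.2 hne
  -- Cover `Z` so that only `c₀` may contain `p`. The part of a finite subcover lying in the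
  -- closed-off family must already cover, hence contains `c₀`.
  have hcov : ∀ q, ∃ c ∈ C, q ∈ c ∧ (p ∈ c → c = c₀) := fun q => by
    by_cases hq : q = p
    · exact ⟨c₀, hc₀, hq ▸ hp, fun _ => rfl⟩
    · obtain ⟨c, hc, hqc, hcp⟩ := hC.exists_subset_of_mem_open
        (show q ∈ ({p}ᶜ : Set Z) from hq) isOpen_compl_singleton
      exact ⟨c, hc, hqc, fun h => (hcp h rfl).elim⟩
  choose c hcC hqc hcp using hcov
  obtain ⟨t, ht⟩ := isCompact_univ.elim_finite_subcover c (fun q => hC.isOpen (hcC q))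
    fun q _ => Set.mem_iUnion.2 ⟨q, hqc q⟩
  let F : Finset (Set Z) := (t.image c).filter (· ∈ ⋃ n : ULift.{u} ℕ, M n.down)
  obtain ⟨n, hn⟩ : ∃ n, ∀ s ∈ F, s ∈ M n := by
    have : ∀ s ∈ F, ∃ n, s ∈ M n := fun s hs => by
      obtain ⟨n, hn⟩ := Set.mem_iUnion.1 (Finset.mem_filter.1 hs).2
      exact ⟨n.down, hn⟩
    choose! g hg using this
    exact ⟨F.sup g, fun s hs => hmono (Finset.le_sup (f := g) hs) (hg s hs)⟩
  have hF : ⋃₀ (F : Set (Set Z)) = Set.univ := by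
    by_contra hF
    have hz := hpt F hF
    obtain ⟨q, hq, hzq⟩ := Set.mem_iUnion₂.1 (ht (Set.mem_univ (pt F)))
    refine hz ⟨c q, ?_, hzq⟩
    refine Finset.mem_filter.2 ⟨Finset.mem_image_of_mem c hq, Set.mem_iUnion.2 ⟨⟨n + 1⟩, ?_⟩⟩
    change _ ∈ M (n + 1)
    rw [hM]
    have hFe : (F.subtype (· ∈ M n)).map (Function.Embedding.subtype _) = F :=
      Finset.subtype_map_of_mem hn
    rw [← hFe] at hzq
    exact Or.inr (Set.mem_iUnion.2 ⟨F.subtype (· ∈ M n), hcC q, hzq⟩)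
  obtain ⟨s, hs, hps⟩ : p ∈ ⋃₀ (F : Set (Set Z)) := hF ▸ Set.mem_univ p
  obtain ⟨hs1, hs2⟩ := Finset.mem_filter.1 hs
  obtain ⟨q, -, rfl⟩ := Finset.mem_image.1 hs1
  rwa [← hcp q hps]

/-- In a `μ^op`-like base, each point has a local base of fewer than `μ` members, and every member
through the point is a superset of one of these. Regularity bounds their number by less than `μ`, so
Mishchenko's lemma applies. -/
theorem lt_Nt_of_hasNhdsBaseLT {Z : Type u} [TopologicalSpace Z] [CompactSpace Z] [T2Space Z]
    {μ : Cardinal.{u}} (hμ : μ.IsRegular) (hμ' : ℵ₀ < μ) (hloc : ∀ z : Z, HasNhdsBaseLT μ z)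
    (hw : ∀ D : Set (Set Z), IsTopologicalBasis D → μ ≤ #D) : μ < Nt Z := by
  by_contra! hle
  obtain ⟨-, C, hC, hop⟩ := exists_isOpLikeFamily_Nt Z
  rw [isOpLikeFamily_iff] at hop
  refine (hw _ hC.sdiff_empty).not_gt (mk_lt_of_forall_mk_mem_lt hμ hμ' hC fun z => ?_)
  obtain ⟨S, hS, h1, h2⟩ := hloc z
  have : ∀ s : S, ∃ e ∈ C, z ∈ e ∧ e ⊆ s := fun s =>
    hC.exists_subset_of_mem_open (h1 s s.2).2 (h1 s s.2).1
  choose e he hze hes using this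
  refine lt_of_le_of_lt (mk_le_mk_of_subset ?_) ((card_iUnion_lt_iff_forall_of_isRegular hμ hS
    (t := fun s => {x : Set Z | x ∈ C ∧ e s ⊆ x})).2 fun s => (hop _ (he s)).trans_le hle)
  rintro c ⟨hc, hzc⟩
  obtain ⟨s, hs, hsc⟩ := h2 c (hC.isOpen hc) hzc
  exact Set.mem_iUnion.2 ⟨⟨s, hs⟩, hc, (hes _).trans hsc⟩

end LocalBase

/-! ### Recursive selection of an op-like base inside a given base. -/

section Selection

open Topology

/-- Well-order `I` in its least order type: at each stage fewer than `κ` finite sets, hence fewer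
than `κ` elements, have been used. -/
theorem exists_pairwise_disjoint_finset {I T : Type u} {κ : Cardinal.{u}} (hκ : ℵ₀ ≤ κ)
    (hI : #I ≤ κ) (P : I → Finset T → Prop)
    (hP : ∀ i, ∀ used : Set T, #used < κ → ∃ s, P i s ∧ Disjoint (s : Set T) used) :
    ∃ G : I → Finset T, (∀ i, P i (G i)) ∧ Pairwise fun i j => Disjoint (G i) (G j) := by
  obtain ⟨r, hr, hord⟩ := exists_ord_eq I
  let used : ∀ i, (∀ j, r j i → Finset T) → Set T := fun i g => ⋃ j : {j // r j i}, g j.1 j.2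
  have hused : ∀ i g, #(used i g) < κ := fun i g => by
    have hlt : #{j // r j i} < κ := (card_typein_lt i hord).trans_le hI
    rcases finite_or_infinite {j // r j i} with hf | hf
    · have : (used i g).Finite := Set.finite_iUnion fun j => Finset.finite_toSet _
      exact (lt_aleph0_iff_set_finite.2 this).trans_le hκ
    · refine lt_of_le_of_lt (mk_iUnion_le_sum_mk.trans (sum_le_sum _ (fun _ => ℵ₀) fun j => ?_)) ?_
      · exact (lt_aleph0_iff_set_finite.2 (Finset.finite_toSet _)).le
      · rwa [sum_const', mul_aleph0_eq (aleph0_le_mk _)]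
  choose F hF hFd using fun i g => hP i (used i g) (hused i g)
  let G : I → Finset T := hr.wf.fix F
  have hG : ∀ i, G i = F i fun j _ => G j := fun i => hr.wf.fix_eq F i
  have hdis : ∀ i j, r j i → Disjoint (G i) (G j) := fun i j hji => by
    rw [← Finset.disjoint_coe]
    have := hFd i fun j _ => G j
    rw [← hG i] at this
    exact this.mono_right (Set.subset_iUnion (fun j : {j // r j i} => (G j.1 : Set T)) ⟨j, hji⟩)
  refine ⟨G, fun i => hG i ▸ hF _ _, fun i j hij => ?_⟩
  rcases trichotomous_of r i j with h | h | h
  · exact (hdis j i h).symm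
  · exact (hij h).elim
  · exact hdis i j h

/-- Transfer of `κ^op`-like bases along a map `d : X → Y` and a monotone extension `Φ` of open
sets: if every `d p` lies in at least `w(X)` members of a `κ^op`-like base of `Y`, then every base
of `X` contains a `κ^op`-like base. -/
theorem exists_isOpLikeFamily_subset {X Y : Type u} [TopologicalSpace X] [CompactSpace X]
    [T2Space X] [TopologicalSpace Y] (d : X → Y) (Φ : Set X → Set Y) (hΦ : Monotone Φ)
    (hΦo : ∀ W, IsOpen W → W.Nonempty → IsOpen (Φ W) ∧ (Φ W).Nonempty)
    (hΦd : ∀ p V, IsOpen V → d p ∈ V → ∃ U, IsOpen U ∧ p ∈ U ∧ Φ U ⊆ V)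
    {κ : Cardinal.{u}} (hκ : ℵ₀ ≤ κ) {C : Set (Set Y)} (hC : IsTopologicalBasis C)
    (hop : IsOpLikeFamily κ C) (hw : ∀ p, weight X ≤ #{c : Set Y | c ∈ C ∧ d p ∈ c})
    {A : Set (Set X)} (hA : IsTopologicalBasis A) :
    ∃ B ⊆ A, IsTopologicalBasis B ∧ IsOpLikeFamily κ B := by
  classical
  obtain ⟨hw0, D, hD, hDw⟩ := exists_basis_mk_le_weight X
  let I := {q : D × D // closure q.1.1 ⊆ q.2.1}
  have hI : #I ≤ weight X := calc
    #I ≤ #(D × D) := mk_subtype_le _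
    _ = #D * #D := by simp
    _ ≤ weight X * weight X := mul_le_mul' hDw hDw
    _ = weight X := mul_eq_self hw0
  let P : I → Finset C → Prop := fun i s => ∃ 𝒲 : Set (Set X), 𝒲.Finite ∧ 𝒲 ⊆ A ∧
    closure i.1.1.1 ⊆ ⋃₀ 𝒲 ∧ ∀ W ∈ 𝒲, W.Nonempty ∧ W ⊆ i.1.2.1 ∧ ∃ c ∈ s, Φ W ⊆ c.1
  have hP : ∀ i, ∀ used : Set C, #used < weight X → ∃ s, P i s ∧ Disjoint (s : Set C) used := by
    rintro ⟨⟨⟨U, hU⟩, ⟨V, hV⟩⟩, hUV⟩ used hused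
    have : ∀ p : X, ∃ c : C, c ∉ used ∧ (p ∈ V → ∃ W ∈ A, p ∈ W ∧ W ⊆ V ∧ Φ W ⊆ c.1) := fun p => by
      -- Fewer than `w(X)` used members cannot exhaust those through `d p`.
      obtain ⟨c, hc, hpc⟩ : ∃ c : C, c ∉ used ∧ d p ∈ c.1 := by
        by_contra! hcon
        refine ((hw p).trans ?_).not_gt hused
        refine le_trans (mk_le_mk_of_subset (t := Subtype.val '' used) ?_) mk_image_le
        rintro c ⟨hc, hpc⟩
        by_contra hcu
        exact hcon ⟨c, hc⟩ (fun h => hcu ⟨_, h, rfl⟩) hpc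
      refine ⟨c, hc, fun hpV => ?_⟩
      obtain ⟨O, hO, hpO, hOc⟩ := hΦd p c.1 (hC.isOpen c.2) hpc
      obtain ⟨W, hW, hpW, hWO⟩ :=
        hA.exists_subset_of_mem_open (Set.mem_inter hpV hpO) ((hD.isOpen hV).inter hO)
      exact ⟨W, hW, hpW, hWO.trans Set.inter_subset_left,
        (hΦ (hWO.trans Set.inter_subset_right)).trans hOc⟩
    choose c hcu hc using this
    choose! W hWA hpW hWV hWc using hc
    obtain ⟨t, htU, ht⟩ := isClosed_closure (s := U).isCompact.elim_nhds_subcover W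
      fun p hp => (hA.isOpen (hWA p (hUV hp))).mem_nhds (hpW p (hUV hp))
    refine ⟨t.image c, ⟨W '' t, t.finite_toSet.image W, ?_, ?_, ?_⟩, ?_⟩
    · rintro _ ⟨p, hp, rfl⟩
      exact hWA p (hUV (htU p hp))
    · rw [Set.sUnion_image]
      exact ht
    · rintro _ ⟨p, hp, rfl⟩
      have hpV := hUV (htU p hp)
      exact ⟨⟨p, hpW p hpV⟩, hWV p hpV, c p, Finset.mem_image_of_mem c hp, hWc p hpV⟩
    · rw [Set.disjoint_left]
      intro x hx
      obtain ⟨p, -, rfl⟩ := Finset.mem_image.1 (Finset.mem_coe.1 hx)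
      exact hcu p
  obtain ⟨G, hG, hGd⟩ := exists_pairwise_disjoint_finset hw0 hI P hP
  choose 𝒲 hfin hsub hcov hprop using hG
  have hBA : (⋃ i, 𝒲 i) ⊆ A := Set.iUnion_subset hsub
  refine ⟨⋃ i, 𝒲 i, hBA, ?_, ?_⟩
  · refine isTopologicalBasis_of_isOpen_of_nhds (fun W hW => hA.isOpen (hBA hW))
      fun p O hp hO => ?_
    obtain ⟨V, hV, hpV, hVO⟩ := hD.exists_subset_of_mem_open hp hO
    obtain ⟨U, hU, hpU, hUV⟩ := hD.exists_closure_subset ((hD.isOpen hV).mem_nhds hpV)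
    let i : I := ⟨(⟨U, hU⟩, ⟨V, hV⟩), hUV⟩
    obtain ⟨W, hW, hpW⟩ := hcov i (subset_closure hpU)
    exact ⟨W, Set.mem_iUnion.2 ⟨i, hW⟩, hpW, (hprop i W hW).2.1.trans hVO⟩
  · have : ∀ W : ↥(⋃ i, 𝒲 i), ∃ i, W.1 ∈ 𝒲 i ∧ ∃ c ∈ G i, Φ W ⊆ c.1 := fun W => by
      obtain ⟨i, hi⟩ := Set.mem_iUnion.1 W.2
      exact ⟨i, hi, (hprop i W hi).2.2⟩
    choose idx hidx f hf hfW using this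
    rw [isOpLikeFamily_iff] at hop ⊢
    intro W hW
    obtain ⟨i, hi⟩ := Set.mem_iUnion.1 hW
    obtain ⟨hΦ1, hΦ2⟩ := hΦo W (hA.isOpen (hBA hW)) (hprop i W hi).1
    -- Each selected `W' ⊇ W` is assigned a member of `C` containing `Φ W'`, hence a superset of
    -- `E`. By disjointness of the `G i`, a member of `C` serves only one index, so this assignment
    -- has finite fibres.
    obtain ⟨E, hE, -, hEW⟩ := hC.exists_subset_of_mem_open hΦ2.some_mem hΦ1
    let g : {x | x ∈ (⋃ i, 𝒲 i) ∧ W ⊆ x} → {x : Set Y | x ∈ C ∧ E ⊆ x} := fun W' =>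
      ⟨f ⟨W', W'.2.1⟩, (f _).2, hEW.trans ((hΦ W'.2.2).trans (hfW ⟨W', W'.2.1⟩))⟩
    refine mk_lt_of_finite_preimage hκ g (fun b => ?_) (hop E hE)
    refine Set.Finite.of_finite_image (f := Subtype.val) ?_ Subtype.val_injective.injOn
    rcases Set.eq_empty_or_nonempty (g ⁻¹' {b}) with h0 | ⟨W₀, hW₀⟩
    · rw [h0]; simp
    · refine (hfin (idx ⟨W₀, W₀.2.1⟩)).subset ?_
      rintro _ ⟨W₁, hW₁, rfl⟩
      have hff : f ⟨W₁, W₁.2.1⟩ = f ⟨W₀, W₀.2.1⟩ :=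
        Subtype.ext (congrArg (fun z => z.1) (show g W₁ = g W₀ from hW₁.trans hW₀.symm))
      have : idx ⟨W₁, W₁.2.1⟩ = idx ⟨W₀, W₀.2.1⟩ := by
        by_contra hne
        exact Finset.disjoint_left.1 (hGd hne) (hf _) (hff ▸ hf _)
      exact this ▸ hidx _

end Selection

/-! ### Arhangelskii's bound through well-founded terms. -/

section Arhangelskii

open Topology Filter

theorem WType.mk_le_two_power {α Λ : Type u} [Infinite Λ] (hα : #α ≤ #Λ) :
    #(WType fun a : Option α => a.elim PEmpty.{u + 1} fun _ => Λ) ≤ 2 ^ #Λ := by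
  have hΛ := aleph0_le_mk Λ
  have h2 : ℵ₀ ≤ 2 ^ #Λ := hΛ.trans (cantor _).le
  refine WType.cardinalMk_le_of_le ((sum_le_sum _ (fun _ => 2 ^ #Λ) ?_).trans ?_)
  · rintro (_ | a)
    · simpa using one_lt_aleph0.le.trans h2
    · change (2 ^ #Λ) ^ #Λ ≤ 2 ^ #Λ
      rw [← power_mul, mul_eq_self hΛ]
  · rw [sum_const', mk_option]
    refine (mul_le_mul' ?_ le_rfl).trans (mul_eq_self h2).le
    exact (add_le_add_left hα 1).trans ((add_one_eq hΛ).le.trans (cantor _).le)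

/-- Arhangelskii's bound: a compact Hausdorff space with local bases of cardinality `#Λ` has at
most `2 ^ #Λ` points. -/
theorem mk_le_two_power_of_nhds {X Λ : Type u} [TopologicalSpace X] [CompactSpace X] [T2Space X]
    [Infinite Λ] (U : X → Λ → Set X) (hU : ∀ x i, IsOpen (U x i) ∧ x ∈ U x i)
    (hUb : ∀ x O, IsOpen O → x ∈ O → ∃ i, U x i ⊆ O) : #X ≤ 2 ^ #Λ := by
  classical
  rcases isEmpty_or_nonempty X with hX | hX
  · simp
  have hout : ∀ K : Set X, ∃ x, K ≠ Set.univ → x ∉ K := fun K => by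
    by_cases hK : K = Set.univ
    · exact ⟨Classical.arbitrary X, fun h => (h hK).elim⟩
    · obtain ⟨z, hz⟩ := (Set.ne_univ_iff_exists_notMem _).1 hK
      exact ⟨z, fun _ => hz⟩
  choose out hout using hout
  let Λ' := Finset Λ
  -- Two kinds of operation: the limit of a net indexed by finite subsets of `Λ`, and a point
  -- outside a finite union of neighbourhoods coded by `s`. The terms built from one constant number
  -- at most `2 ^ #Λ`, and their values are closed under both operations, which makes them all of
  -- `X`.
  let op : (Option (Finset (Λ' × Λ)) × (Λ' → X)) → X := fun q => match q with
    | (none, g) => limUnder atTop g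
    | (some s, g) => out (⋃ q ∈ s, U (g q.1) q.2)
  let T := WType fun a : Option (Option (Finset (Λ' × Λ))) => a.elim PEmpty.{u + 1} fun _ => Λ'
  let ev : T → X := WType.elim X fun q => match q with
    | ⟨none, _⟩ => Classical.arbitrary X
    | ⟨some a, g⟩ => op (a, g)
  have hev : ∀ a (g : Λ' → X), (∀ i, g i ∈ Set.range ev) → op (a, g) ∈ Set.range ev := by
    intro a g hg
    choose t ht using hg
    refine ⟨WType.mk (some a) t, ?_⟩
    change op (a, fun i => ev (t i)) = _
    simp_rw [ht]
  have hT : #T ≤ 2 ^ #Λ := by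
    have h1 : #Λ' = #Λ := mk_finset_of_infinite Λ
    rw [← h1]
    refine WType.mk_le_two_power (le_of_eq ?_)
    rw [mk_option, mk_finset_of_infinite, mk_prod, lift_id, lift_id, h1,
      mul_eq_self (aleph0_le_mk Λ), add_one_eq (aleph0_le_mk Λ)]
  set H := Set.range ev with hH
  have hne : H.Nonempty := ⟨_, WType.mk none PEmpty.elim, rfl⟩
  have hclosed : IsClosed H := by
    refine isClosed_of_closure_subset fun p hp => ?_
    -- These points form a net in `H` converging to `p`, so the limit operation returns `p`.
    have : ∀ F : Λ', ∃ x ∈ H, ∀ i ∈ F, x ∈ U p i := fun F => by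
      obtain ⟨x, hx, hxH⟩ := mem_closure_iff.1 hp (⋂ i ∈ F, U p i)
        (isOpen_biInter_finset fun i _ => (hU p i).1) (Set.mem_iInter₂.2 fun i _ => (hU p i).2)
      exact ⟨x, hxH, fun i hi => Set.mem_iInter₂.1 hx i hi⟩
    choose g hgH hgU using this
    have hlim : Tendsto g atTop (𝓝 p) := by
      intro O hO
      obtain ⟨O', hO'O, hO', hpO'⟩ := mem_nhds_iff.1 hO
      obtain ⟨i, hi⟩ := hUb p O' hO' hpO'
      exact mem_atTop_sets.2 ⟨{i}, fun F hF => hO'O (hi (hgU F i (hF (Finset.mem_singleton_self i))))⟩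
    have := hev none g hgH
    change limUnder atTop g ∈ H at this
    rwa [hlim.limUnder_eq] at this
  have huniv : H = Set.univ := by
    by_contra hHne
    obtain ⟨q, hq⟩ := (Set.ne_univ_iff_exists_notMem _).1 hHne
    have : ∀ x, ∃ i, x ≠ q → q ∉ U x i := fun x => by
      by_cases hx : x = q
      · exact ⟨Classical.arbitrary Λ, fun h => (h hx).elim⟩
      · obtain ⟨i, hi⟩ := hUb x {q}ᶜ isOpen_compl_singleton hx
        exact ⟨i, fun _ h => hi h rfl⟩
    choose k hk using this
    -- This finite cover of `H` misses `q`, yet the operation `out` applied to its code yields a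
    -- point of `H` outside it.
    obtain ⟨t, htH, ht⟩ := hclosed.isCompact.elim_nhds_subcover (fun x => U x (k x))
      fun x _ => (hU x _).1.mem_nhds (hU x _).2
    obtain ⟨e⟩ : Nonempty (t ↪ Λ') :=
      le_def _ _ |>.1 ((lt_aleph0_of_finite t).le.trans (aleph0_le_mk Λ'))
    let g : Λ' → X := Function.extend e Subtype.val fun _ => hne.some
    have hge : ∀ x : t, g (e x) = x := fun x => e.injective.extend_apply _ _ _
    have hgH : ∀ i, g i ∈ H := fun i => by
      by_cases hi : ∃ x, e x = i
      · obtain ⟨x, rfl⟩ := hi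
        rw [hge]
        exact htH x x.2
      · rw [show g i = _ from Function.extend_apply' _ _ _ hi]
        exact hne.some_mem
    let s : Finset (Λ' × Λ) := Finset.univ.image fun x : t => (e x, k x)
    have hs : (⋃ q ∈ s, U (g q.1) q.2) = ⋃ x ∈ t, U x (k x) := by
      ext y
      simp [s, hge]
    have hqs : (⋃ x ∈ t, U x (k x)) ≠ Set.univ := fun h => by
      obtain ⟨x, hx, hqx⟩ := Set.mem_iUnion₂.1 (h ▸ Set.mem_univ q)
      exact hk x (fun h => hq (h ▸ htH x hx)) hqx
    have := hev (some s) g hgH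
    change out (⋃ q ∈ s, U (g q.1) q.2) ∈ H at this
    rw [hs] at this
    exact hout _ hqs (ht this)
  calc #X = #(Set.univ : Set X) := mk_univ.symm
    _ = #H := by rw [huniv]
    _ ≤ #T := mk_range_le
    _ ≤ 2 ^ #Λ := hT

theorem weight_le_two_power_of_hasNhdsBaseLT {X : Type u} [TopologicalSpace X] [CompactSpace X]
    [T2Space X] {κ : Cardinal.{u}} (hκ : ℵ₀ ≤ κ) (h : ∀ x : X, HasNhdsBaseLT (Order.succ κ) x) :
    weight X ≤ 2 ^ κ := by
  induction κ using Cardinal.inductionOn with | _ Λ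
  have : Infinite Λ := infinite_iff.2 hκ
  have : ∀ x : X, ∃ V : Λ → Set X, (∀ i, IsOpen (V i) ∧ x ∈ V i) ∧
      ∀ O, IsOpen O → x ∈ O → ∃ i, V i ⊆ O := fun x => by
    obtain ⟨S, hS, h1, h2⟩ := h x
    obtain ⟨e⟩ := le_def _ _ |>.1 (Order.lt_succ_iff.1 hS)
    obtain ⟨s₀, hs₀, -⟩ := h2 _ isOpen_univ trivial
    refine ⟨Function.extend e Subtype.val fun _ => s₀, fun i => ?_, fun O hO hx => ?_⟩
    · by_cases hi : ∃ x, e x = i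
      · obtain ⟨y, rfl⟩ := hi
        rw [e.injective.extend_apply]
        exact h1 y y.2
      · rw [Function.extend_apply' _ _ _ hi]
        exact h1 _ hs₀
    · obtain ⟨s, hs, hsO⟩ := h2 O hO hx
      exact ⟨e ⟨s, hs⟩, by rwa [e.injective.extend_apply]⟩
  choose U hU hUb using this
  have hX := mk_le_two_power_of_nhds U hU hUb
  have hinf : ℵ₀ ≤ 2 ^ #Λ := hκ.trans (cantor _).le
  refine weight_le hinf (B := Set.range fun q : X × Λ => U q.1 q.2) ?_ ?_
  · refine isTopologicalBasis_of_isOpen_of_nhds ?_ fun p O hp hO => ?_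
    · rintro _ ⟨q, rfl⟩
      exact (hU _ _).1
    · obtain ⟨i, hi⟩ := hUb p O hO hp
      exact ⟨_, ⟨(p, i), rfl⟩, (hU _ _).2, hi⟩
  · calc _ ≤ #(X × Λ) := mk_range_le
      _ = #X * #Λ := by simp
      _ ≤ 2 ^ #Λ * 2 ^ #Λ := mul_le_mul' hX (cantor _).le
      _ = _ := mul_eq_self hinf

end Arhangelskii

/-! ### The dichotomy for homogeneous compacta, and powers. -/

section Homogeneous

open Topology

theorem GCH.everyLimitIsStrongLimit (h : GCH.{u}) : EveryLimitIsStrongLimit.{u} := by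
  refine fun κ hκ => ⟨hκ.bot_lt.ne', fun x hx => ?_⟩
  rcases lt_or_ge x ℵ₀ with hfin | hinf
  · exact (power_lt_aleph0 natCast_lt_aleph0 hfin).trans_le (aleph0_le_of_isSuccLimit hκ)
  · rw [h x hinf]
    exact hκ.succ_lt hx

theorem discreteTopology_of_hasNhdsBaseLT_aleph0 {X : Type u} [TopologicalSpace X] [T1Space X]
    (hX : ∀ x : X, HasNhdsBaseLT ℵ₀ x) :
    DiscreteTopology X :=
  discreteTopology_iff_isOpen_singleton.2 fun x => (hX x).isOpen_singleton

/-- Used with `d` the identity and the diagonal of a power. A base of `Z` smaller than `w(X)` would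
pull back to one of `X`. -/
theorem weight_lt_Nt {X Z : Type u} [TopologicalSpace X] [TopologicalSpace Z] [CompactSpace Z]
    [T2Space Z]
    (hw : (weight X).IsRegular) (hw' : ℵ₀ < weight X) {d : X → Z} (hd : IsInducing d)
    (hZ : ∀ z : Z, HasNhdsBaseLT (weight X) z) : weight X < Nt Z := by
  refine lt_Nt_of_hasNhdsBaseLT hw hw' hZ fun D hD => ?_
  by_contra! hlt
  have := weight_le (le_max_right _ _) (hD.isInducing hd) (le_max_left _ ℵ₀)
  exact this.not_gt (max_lt (mk_image_le.trans_lt hlt) hw')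

variable {X : Type u} [TopologicalSpace X] [CompactSpace X] [T2Space X]

theorem EveryLimitIsStrongLimit.weight_isRegular (h : EveryLimitIsStrongLimit.{u})
    (hX : IsHomogeneousSpace X) {p : X} (hp : HasNhdsBaseLT (weight X) p) :
    (weight X).IsRegular := by
  have hw := aleph0_le_weight X
  by_cases hlim : Order.IsSuccPrelimit (weight X)
  · rcases hw.eq_or_lt with hw | hw
    · rw [← hw]
      exact isRegular_aleph0
    obtain ⟨S, hS, hSp⟩ := hp
    have hlt : max #S ℵ₀ < weight X := max_lt hS hw
    have hstrong := h (weight X) (Cardinal.isSuccLimit_iff.2 ⟨(aleph0_pos.trans hw).ne', hlim⟩)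
    refine ((hstrong.isStrongPrelimit hlt).not_ge ?_).elim
    exact weight_le_two_power_of_hasNhdsBaseLT (le_max_right _ _) fun x =>
      hX.hasNhdsBaseLT ⟨S, Order.lt_succ_of_le (le_max_left _ _), hSp⟩ x
  · obtain ⟨c, -, hc⟩ := Order.not_isSuccPrelimit_iff_succ_eq.1 hlim
    rw [← hc] at hw ⊢
    refine isRegular_succ ?_
    by_contra! hc'
    exact hw.not_gt (isSuccLimit_aleph0.succ_lt hc')

theorem everyBaseContainsNtOpLikeBase_of_not_hasNhdsBaseLT
    (hX : ∀ x : X, ¬ HasNhdsBaseLT (weight X) x) : EveryBaseContainsNtOpLikeBase X := by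
  obtain ⟨hκ, C, hC, hop⟩ := exists_isOpLikeFamily_Nt X
  exact fun A hA => exists_isOpLikeFamily_subset id id monotone_id (fun W hW hne => ⟨hW, hne⟩)
    (fun p V hV hp => ⟨V, hV, hp, subset_rfl⟩) hκ hC hop
    (fun p => le_mk_of_not_hasNhdsBaseLT IsInducing.id (hX p) hC) hA

/-- Regularity is asked for only in the presence of a small local base, which is what Arhangelskii's
bound needs to supply it. -/
theorem IsHomogeneousSpace.everyBaseContainsNtOpLikeBase (hX : IsHomogeneousSpace X)
    (h : ∀ p : X, HasNhdsBaseLT (weight X) p → (weight X).IsRegular) :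
    EveryBaseContainsNtOpLikeBase X := by
  by_cases hp : ∃ p : X, HasNhdsBaseLT (weight X) p
  · obtain ⟨p, hp⟩ := hp
    have hloc := hX.hasNhdsBaseLT hp
    have hreg := h p hp
    rcases hreg.aleph0_le.eq_or_lt with hw | hw
    · rw [← hw] at hloc
      have := discreteTopology_of_hasNhdsBaseLT_aleph0 hloc
      exact everyBaseContainsNtOpLikeBase_of_discrete
    · exact everyBaseContainsNtOpLikeBase_of_weight_lt (weight_lt_Nt hreg hw .id hloc)
  · exact everyBaseContainsNtOpLikeBase_of_not_hasNhdsBaseLT fun x hx => hp ⟨x, hx⟩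

theorem isInducing_diagonal (X : Type u) [TopologicalSpace X] {ι : Type} [Nonempty ι] :
    IsInducing fun (x : X) (_ : ι) => x :=
  (Function.LeftInverse.isEmbedding (f := fun y : ι → X => y (Classical.arbitrary ι))
    (fun _ => rfl) (continuous_apply _) (continuous_pi fun _ => continuous_id)).isInducing

/-- The selection argument with `d` the diagonal and `Φ W` the cube over `W`: points of the diagonal
lie in at least `w(X)` members of any base of the power. -/
theorem Nt_le_Nt_pi {ι : Type} [Finite ι] [Nonempty ι]
    (hX : ∀ x : X, ¬ HasNhdsBaseLT (weight X) x) : Nt X ≤ Nt (ι → X) := by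
  obtain ⟨hκ, C, hC, hop⟩ := exists_isOpLikeFamily_Nt (ι → X)
  obtain ⟨B, -, hB, hBop⟩ := exists_isOpLikeFamily_subset (fun (x : X) (_ : ι) => x)
    (fun W => Set.univ.pi fun _ => W) (fun V W hVW => Set.pi_mono fun _ _ => hVW)
    (fun W hW hne => ⟨isOpen_set_pi Set.finite_univ fun _ _ => hW,
      Set.univ_pi_nonempty_iff.2 fun _ => hne⟩)
    (fun p V hV hp => by
      obtain ⟨I, u, hu, huV⟩ := isOpen_pi_iff.1 hV _ hp
      refine ⟨⋂ i ∈ I, u i, isOpen_biInter_finset fun i hi => (hu i hi).1,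
        Set.mem_iInter₂.2 fun i hi => (hu i hi).2, fun q hq => huV fun i hi => ?_⟩
      exact Set.mem_iInter₂.1 (hq i trivial) i hi)
    hκ hC hop (fun p => le_mk_of_not_hasNhdsBaseLT (isInducing_diagonal X) (hX p) hC)
    isTopologicalBasis_opens
  exact Nt_le hκ hB hBop

theorem IsHomogeneousSpace.Nt_pi (hX : IsHomogeneousSpace X)
    (h : ∀ p : X, HasNhdsBaseLT (weight X) p → (weight X).IsRegular)
    {ι : Type} [Finite ι] [Nonempty ι] : Nt (ι → X) = Nt X := by
  refine le_antisymm Nt_pi_le ?_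
  by_cases hp : ∃ p : X, HasNhdsBaseLT (weight X) p
  · obtain ⟨p, hp⟩ := hp
    have hloc := hX.hasNhdsBaseLT hp
    have hreg := h p hp
    rcases hreg.aleph0_le.eq_or_lt with hw | hw
    · rw [← hw] at hloc
      have := discreteTopology_of_hasNhdsBaseLT_aleph0 hloc
      rw [Nt_eq_aleph0_of_discrete]
      exact aleph0_le_Nt _
    · exact (Nt_le_succ_weight X).trans (Order.succ_le_of_lt
        (weight_lt_Nt hreg hw (isInducing_diagonal X) fun z => .pi hreg.aleph0_le fun i => hloc _))
  · exact Nt_le_Nt_pi fun x hx => hp ⟨x, hx⟩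

end Homogeneous

theorem mainTheorem7 :
    (∀ (X : Type u) [TopologicalSpace X] [CompactSpace X] [T2Space X],
      IsHomogeneousSpace X → (weight X).IsRegular → EveryBaseContainsNtOpLikeBase X) ∧
    (EveryLimitIsStrongLimit.{u} →
      ∀ (X : Type u) [TopologicalSpace X] [CompactSpace X] [T2Space X],
        IsHomogeneousSpace X → EveryBaseContainsNtOpLikeBase X) ∧
    (GCH.{u} →
      ∀ (X : Type u) [TopologicalSpace X] [CompactSpace X] [T2Space X],
        IsHomogeneousSpace X → ∀ n : ℕ, 1 ≤ n → Nt (Fin n → X) = Nt X) := by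
  refine ⟨fun X _ _ _ hX hw => hX.everyBaseContainsNtOpLikeBase fun _ _ => hw,
    fun h X _ _ _ hX => hX.everyBaseContainsNtOpLikeBase fun _ hp => h.weight_isRegular hX hp,
    fun h X _ _ _ hX n hn => ?_⟩
  have : Nonempty (Fin n) := ⟨⟨0, hn⟩⟩
  exact hX.Nt_pi fun _ hp => h.everyLimitIsStrongLimit.weight_isRegular hX hp
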